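/- Let $A\in\mathbb R^{n\times n}$, $B\in\mathbb R^{n\times m}$, $C\in\mathbb R^{\nu\times n}$, $D\in\mathbb R^{\nu\times m}$ and form the augmented system $$\Phi=\begin{bmatrix}A&B\\0&\mathbb I_m\end{bmatrix},\qquad H=\begin{bmatrix}C&D\\0&\mathbb I_m\end{bmatrix}.$$ Let $Q\succeq0$ and $R\succ0$ be symmetric real covariance matrices of sizes $n+m$ and $\nu+m$, let $P_{0(-)}\succeq 0$ be any initial covariance (e.g. $P_{0(-)}=Q$), and consider the Kalman filter and the Rauch–Tung–Striebel (RTS) smoother gains, for $k\ge0$, $$K_k=P_{k(-)}H^\top(HP_{k(-)}H^\top+R)^{-1},\quad P_{k(+)}=(\mathbb I-K_kH)P_{k(-)},\quad P_{k+1(-)}=\Phi P_{k(+)}\Phi^\top+Q,\quad L_k=P_{k(+)}\Phi^\top P_{k+1(-)}^{-1}.$$ Suppose that the infinite-time Kalman gain $K_\infty=\lim_k K_k$ exists and that the error dynamics can be stabilized, i.e. there is a gain $K$ such that all eigenvalues of $(\mathbb I-KH)\Phi$ lie strictly inside the unit circle (in particular, this holds if $K_\infty$ itself is such a stabilizing gain).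 Then the limits $P_{\infty(-)}=\lim_k P_{k(-)}$ and $P_{\infty(+)}=\lim_k P_{k(+)}$ exist and satisfy the steady-state filter equations $$K_\infty=P_{\infty(-)}H^\top(HP_{\infty(-)}H^\top+R)^{-1},\quad P_{\infty(+)}=(\mathbb I-K_\infty H)P_{\infty(-)},\quad P_{\infty(-)}=\Phi P_{\infty(+)}\Phi^\top+Q,$$ and there exists an infinite-time smoother gain $L_\infty$, i.e. a matrix with $L_\infty P_{\infty(-)}=P_{\infty(+)}\Phi^\top$, all of whose eigenvalues satisfy $|\lambda_i|<1$. If $P_{\infty(-)}$ is invertible, as the usual formula for the smoother gain requires, then $P_{\infty(+)}$ is invertible, $$L_\infty=P_{\infty(+)}\Phi^\top P_{\infty(-)}^{-1}=P_{\infty(+)}\Phi^\top P_{\infty(+)}^{-1}(\mathbb I-K_\infty H)=\lim_{k\to\infty}L_k,$$ and all eigenvalues of $(\mathbb I-K_\infty H)\Phi$ lie strictly inside the unit circle, i.e. $K_\infty$ is stabilizing. -/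

import Mathlib

open Filter Topology

noncomputable section

/-- A real square matrix all of whose (complex) eigenvalues lie strictly inside the unit circle. -/
def SchurStable {ι : Type*} [Fintype ι] [DecidableEq ι] (M : Matrix ι ι ℝ) : Prop :=
  ∀ z : ℂ, Module.End.HasEigenvalue (Matrix.toLin' (M.map (algebraMap ℝ ℂ))) z → ‖z‖ < 1

/-- The augmented state matrix `[A B; 0 I]`. -/
def augPhi {n m : ℕ} (A : Matrix (Fin n) (Fin n) ℝ) (B : Matrix (Fin n) (Fin m) ℝ) :
    Matrix (Fin n ⊕ Fin m) (Fin n ⊕ Fin m) ℝ :=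
  Matrix.fromBlocks A B 0 1

/-- The augmented measurement matrix `[C D; 0 I]`. -/
def augH {n m ν : ℕ} (C : Matrix (Fin ν) (Fin n) ℝ) (D : Matrix (Fin ν) (Fin m) ℝ) :
    Matrix (Fin ν ⊕ Fin m) (Fin n ⊕ Fin m) ℝ :=
  Matrix.fromBlocks C D 0 1

section Filter

variable {ι κ : Type*} [Fintype ι] [DecidableEq ι] [Fintype κ] [DecidableEq κ]

/-- The Kalman gain `P Hᵀ (H P Hᵀ + R)⁻¹` belonging to a prior covariance `P`. -/
def kalmanGain (H : Matrix κ ι ℝ) (R : Matrix κ κ ℝ) (P : Matrix ι ι ℝ) : Matrix ι κ ℝ :=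
  P * H.transpose * (H * P * H.transpose + R)⁻¹

/-- The posterior covariance `(I - K H) P` belonging to a prior covariance `P`, where `K` is
the Kalman gain. -/
def posteriorCov (H : Matrix κ ι ℝ) (R : Matrix κ κ ℝ) (P : Matrix ι ι ℝ) : Matrix ι ι ℝ :=
  (1 - kalmanGain H R P * H) * P

/-- The prior covariances `P_{k(-)}` of the Kalman filter started at `P_{0(-)} = P₀`. -/
def priorSeq (Φ : Matrix ι ι ℝ) (H : Matrix κ ι ℝ) (Q : Matrix ι ι ℝ) (R : Matrix κ κ ℝ)
    (P₀ : Matrix ι ι ℝ) : ℕ → Matrix ι ι ℝ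
  | 0 => P₀
  | k + 1 => Φ * posteriorCov H R (priorSeq Φ H Q R P₀ k) * Φ.transpose + Q

/-- The posterior covariances `P_{k(+)}`. -/
def posteriorSeq (Φ : Matrix ι ι ℝ) (H : Matrix κ ι ℝ) (Q : Matrix ι ι ℝ) (R : Matrix κ κ ℝ)
    (P₀ : Matrix ι ι ℝ) (k : ℕ) : Matrix ι ι ℝ :=
  posteriorCov H R (priorSeq Φ H Q R P₀ k)

/-- The Kalman gains `K_k`. -/
def gainSeq (Φ : Matrix ι ι ℝ) (H : Matrix κ ι ℝ) (Q : Matrix ι ι ℝ) (R : Matrix κ κ ℝ)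
    (P₀ : Matrix ι ι ℝ) (k : ℕ) : Matrix ι κ ℝ :=
  kalmanGain H R (priorSeq Φ H Q R P₀ k)

/-- The Rauch-Tung-Striebel smoother gains `L_k = P_{k(+)} Φᵀ (P_{k+1(-)})⁻¹`. -/
def smootherGainSeq (Φ : Matrix ι ι ℝ) (H : Matrix κ ι ℝ) (Q : Matrix ι ι ℝ) (R : Matrix κ κ ℝ)
    (P₀ : Matrix ι ι ℝ) (k : ℕ) : Matrix ι ι ℝ :=
  posteriorSeq Φ H Q R P₀ k * Φ.transpose * (priorSeq Φ H Q R P₀ (k + 1))⁻¹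

/-- The gain `K` stabilizes the estimation error dynamics `e ↦ (I - K H) Φ e` of the filter
(equivalently, its transpose `Φᵀ (I - Hᵀ Kᵀ)`, the closed loop of the pair `(Φᵀ, Φᵀ Hᵀ)` under
the feedback `Kᵀ`). -/
def IsStabilizingGain (Φ : Matrix ι ι ℝ) (H : Matrix κ ι ℝ) (K : Matrix ι κ ℝ) : Prop :=
  SchurStable ((1 - K * H) * Φ)

end Filter

end

/-! ### Schur stable matrices and recurrences driven by them. -/

section SchurStability

variable {ι : Type*} [Fintype ι] [DecidableEq ι]

/-! Write `S = H P Hᵀ + R`. Convergence: the Riccati recursion, rewritten around a fixed stabilizing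
gain `K₀`, is a stable linear recurrence whose forcing term depends on `P_k` only through `K_k` and
`S_k`. As `(1 - H K_k) S_k = R`, convergence of `K_k` gives that of `S_k` once `1 - H K` is
invertible. This invertibility follows from a bound on `P_k`, obtained by comparison with the
suboptimal filter of constant gain `K₀` (`isUnit_one_sub_mul_gain`, `exists_tendsto_priorSeq`).
Stability: `P₊ Φᵀ = P Fᵀ` with `F = Φ (1 - K H)`, so a nonzero eigenvalue `z` of `L` yields `v` with
`P Fᵀ v = z P v ≠ 0`. The Lyapunov form of the steady-state equation gives `|z| ≤ 1`. If `|z| = 1`,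
then `P v` is an eigenvector of `Φ` invisible to `H`, which no gain could stabilize
(`norm_lt_one_of_riccati`). For invertible `P`, `L` is similar to `Fᵀ`. -/

theorem schurStable_iff_charpoly {M : Matrix ι ι ℝ} :
    SchurStable M ↔
      ∀ z : ℂ, (M.map (algebraMap ℝ ℂ)).charpoly.IsRoot z → ‖z‖ < 1 := by
  simp only [SchurStable, Module.End.hasEigenvalue_iff_isRoot_charpoly, Matrix.charpoly_toLin']

theorem SchurStable.of_charpoly_eq {M N : Matrix ι ι ℝ} (h : M.charpoly = N.charpoly)
    (hM : SchurStable M) : SchurStable N := by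
  rw [schurStable_iff_charpoly, Matrix.charpoly_map] at hM ⊢
  rwa [← h]

theorem SchurStable.norm_lt_one {M : Matrix ι ι ℝ} (hM : SchurStable M) {z : ℂ} {v : ι → ℂ}
    (hv : v ≠ 0) (h : (M.map (algebraMap ℝ ℂ)).mulVec v = z • v) : ‖z‖ < 1 :=
  hM z (Module.End.hasEigenvalue_of_hasEigenvector (x := v)
    ⟨Module.End.mem_eigenspace_iff.2 (by simpa using h), hv⟩)

open scoped Matrix.Norms.Frobenius

/-- Gelfand's formula over `ℂ`; the Frobenius norm does not change when real entries are viewed as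
complex. -/
theorem SchurStable.exists_norm_pow_le {M : Matrix ι ι ℝ} (hM : SchurStable M) :
    ∃ r : ℝ, 0 < r ∧ r < 1 ∧ ∀ᶠ k : ℕ in atTop, ‖M ^ k‖ ≤ r ^ k := by
  set a : Matrix ι ι ℂ := M.map (algebraMap ℝ ℂ) with ha
  have hρ : spectralRadius ℂ a < 1 := by
    by_cases hne : (spectrum ℂ a).Nonempty
    · refine spectrum.spectralRadius_lt_of_forall_lt_of_nonempty hne (r := 1) fun z hz => ?_
      exact schurStable_iff_charpoly.1 hM z (Matrix.mem_spectrum_iff_isRoot_charpoly.1 hz)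
    -- An empty spectrum (empty index type) has spectral radius `0`.
    · rw [Set.not_nonempty_iff_eq_empty] at hne
      simp [spectralRadius, hne]
  obtain ⟨r, hρr, hr1⟩ := ENNReal.lt_iff_exists_nnreal_btwn.1 hρ
  have hr0 : (0 : ℝ) < r := by
    have : (0 : ENNReal) < r := bot_le.trans_lt hρr
    exact_mod_cast this
  refine ⟨r, hr0, by exact_mod_cast hr1, ?_⟩
  have hG := spectrum.pow_norm_pow_one_div_tendsto_nhds_spectralRadius a
  filter_upwards [hG.eventually_lt_const hρr, eventually_gt_atTop 0] with k hk hk0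
  have h1 : ‖a ^ k‖ ^ (1 / k : ℝ) < r := by
    rw [← ENNReal.ofReal_coe_nnreal] at hk
    exact (ENNReal.ofReal_lt_ofReal_iff hr0).1 hk
  have h2 : ‖a ^ k‖ = ‖M ^ k‖ := by
    have : a ^ k = (M ^ k).map (algebraMap ℝ ℂ) :=
      (map_pow (algebraMap ℝ ℂ).mapMatrix M k).symm
    rw [this, Matrix.frobenius_norm_map_eq _ _ (by simp)]
  rw [h2, one_div] at h1
  have hk' : (0 : ℝ) < k := by exact_mod_cast hk0
  have h3 := (Real.rpow_inv_le_iff_of_pos (norm_nonneg (M ^ k)) hr0.le hk').1 h1.le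
  rwa [Real.rpow_natCast] at h3

theorem SchurStable.summable_norm_pow_mul {M : Matrix ι ι ℝ} (hM : SchurStable M) :
    Summable fun k : ℕ => ‖M ^ k‖ * ‖M ^ k‖ := by
  obtain ⟨r, hr0, hr1, h⟩ := hM.exists_norm_pow_le
  refine summable_of_isBigO_nat (g := fun k => (r * r) ^ k)
    (summable_geometric_of_lt_one (by positivity) (by nlinarith)) ?_
  refine Asymptotics.IsBigO.of_bound 1 ?_
  filter_upwards [h] with k hk
  rw [one_mul, Real.norm_of_nonneg (by positivity), Real.norm_of_nonneg (by positivity), mul_pow]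
  gcongr

theorem sylvester_iterate_eq (M : Matrix ι ι ℝ) (X G : ℕ → Matrix ι ι ℝ)
    (h : ∀ k, X (k + 1) = M * X k * M.transpose + G k) (k : ℕ) :
    X k = M ^ k * X 0 * (M ^ k).transpose +
      ∑ i ∈ Finset.range k, M ^ i * G (k - 1 - i) * (M ^ i).transpose := by
  induction k with
  | zero => simp
  | succ k ih =>
    rw [h, ih, Finset.sum_range_succ', mul_add, add_mul, Finset.mul_sum, Finset.sum_mul]
    simp only [pow_succ', Matrix.transpose_mul, pow_zero, Matrix.one_mul, Matrix.transpose_one,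
      Matrix.mul_one, Matrix.mul_assoc, add_assoc]
    congr 2
    refine Finset.sum_congr rfl fun i hi => ?_
    rw [show k + 1 - 1 - (i + 1) = k - 1 - i by omega]

/-- Dominated convergence in the variation-of-constants formula: the `i`-th term is bounded by a
constant times the summable `‖M ^ i‖²`. -/
theorem SchurStable.exists_tendsto_of_recurrence {M : Matrix ι ι ℝ} (hM : SchurStable M)
    {X G : ℕ → Matrix ι ι ℝ} {G' : Matrix ι ι ℝ}
    (h : ∀ k, X (k + 1) = M * X k * M.transpose + G k) (hG : Tendsto G atTop (𝓝 G')) :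
    ∃ X', Tendsto X atTop (𝓝 X') := by
  have hsum := hM.summable_norm_pow_mul
  have hT : ∀ N : Matrix ι ι ℝ, ‖N.transpose‖ = ‖N‖ := fun N => Matrix.frobenius_norm_transpose N
  have hle : ∀ (i : ℕ) (Y : Matrix ι ι ℝ),
      ‖M ^ i * Y * (M ^ i).transpose‖ ≤ ‖M ^ i‖ * ‖M ^ i‖ * ‖Y‖ := fun i Y => by
    calc _ ≤ ‖M ^ i‖ * ‖Y‖ * ‖(M ^ i).transpose‖ :=
          (norm_mul_le _ _).trans (mul_le_mul_of_nonneg_right (norm_mul_le _ _) (norm_nonneg _))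
      _ = _ := by rw [hT]; ring
  obtain ⟨c, hc⟩ := (Metric.isBounded_range_of_tendsto G hG).exists_norm_le
  have hc0 : 0 ≤ c := (norm_nonneg _).trans (hc _ ⟨0, rfl⟩)
  -- Extension by zero turns the finite sums into series over one index set.
  let f : ℕ → ℕ → Matrix ι ι ℝ := fun k i =>
    if i < k then M ^ i * G (k - 1 - i) * (M ^ i).transpose else 0
  have h1 : Tendsto (fun k => ∑' i, f k i) atTop
      (𝓝 (∑' i, M ^ i * G' * (M ^ i).transpose)) := by
    refine tendsto_tsum_of_dominated_convergence (hsum.mul_right c) (fun i => ?_)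
      (Eventually.of_forall fun k i => ?_)
    · have : Tendsto (fun k => G (k - 1 - i)) atTop (𝓝 G') := by
        refine hG.comp ?_
        simpa only [Nat.sub_sub] using tendsto_sub_atTop_nat (1 + i)
      have h2 := (tendsto_const_nhds (x := M ^ i)).mul this |>.mul
        (tendsto_const_nhds (x := (M ^ i).transpose))
      refine h2.congr' ?_
      filter_upwards [eventually_gt_atTop i] with k hk
      simp [f, hk]
    · by_cases hik : i < k
      · simp only [f, hik, if_true]
        exact (hle _ _).trans (mul_le_mul_of_nonneg_left (hc _ ⟨_, rfl⟩) (by positivity))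
      · simp only [f, hik, if_false, norm_zero]
        positivity
  have h0 : Tendsto (fun k => M ^ k * X 0 * (M ^ k).transpose) atTop (𝓝 0) := by
    refine squeeze_zero_norm (fun k => hle k (X 0)) ?_
    simpa using hsum.tendsto_atTop_zero.mul_const ‖X 0‖
  refine ⟨_, (h0.add h1).congr fun k => ?_⟩
  rw [sylvester_iterate_eq M X G h k, tsum_eq_sum (s := Finset.range k)]
  · congr 1
    exact Finset.sum_congr rfl fun i hi => by simp [f, Finset.mem_range.1 hi]
  · intro i hi
    simp [f, Finset.mem_range.not.1 hi]

end SchurStability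

/-! ### Quadratic forms and the innovation covariance. -/

section QuadraticForms

open Matrix

variable {ι κ : Type*} [Fintype ι] [Fintype κ]

theorem Matrix.PosSemidef.congruence {P : Matrix ι ι ℝ} (hP : P.PosSemidef) (M : Matrix κ ι ℝ) :
    (M * P * Mᵀ).PosSemidef := by
  simpa only [conjTranspose_eq_transpose_of_trivial] using hP.mul_mul_conjTranspose_same M

theorem innovation_posDef (H : Matrix κ ι ℝ) {R : Matrix κ κ ℝ} (hR : R.PosDef)
    {P : Matrix ι ι ℝ} (hP : P.PosSemidef) : (H * P * Hᵀ + R).PosDef := by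
  have := hP.mul_mul_conjTranspose_same H
  rw [conjTranspose_eq_transpose_of_trivial] at this
  exact Matrix.PosDef.posSemidef_add this hR

theorem dotProduct_mulVec_comm_of_isSymm {M : Matrix κ κ ℝ} (hM : M.IsSymm) (v w : κ → ℝ) :
    v ⬝ᵥ M *ᵥ w = w ⬝ᵥ M *ᵥ v := by
  rw [dotProduct_mulVec, ← mulVec_transpose, hM, dotProduct_comm]

theorem tendsto_quadForm {α : Type*} {l : Filter α} {M : α → Matrix κ κ ℝ} {M' : Matrix κ κ ℝ}
    {v : α → κ → ℝ} {v' : κ → ℝ} (hM : Tendsto M l (𝓝 M')) (hv : Tendsto v l (𝓝 v')) :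
    Tendsto (fun a => v a ⬝ᵥ M a *ᵥ v a) l (𝓝 (v' ⬝ᵥ M' *ᵥ v')) := by
  have hc : Continuous fun p : Matrix κ κ ℝ × (κ → ℝ) => p.2 ⬝ᵥ p.1 *ᵥ p.2 := by fun_prop
  exact (hc.tendsto (M', v')).comp (hM.prodMk_nhds hv)

theorem kalmanGain_mul_innovation [DecidableEq κ] (H : Matrix κ ι ℝ)
    {R : Matrix κ κ ℝ} (hR : R.PosDef) {P : Matrix ι ι ℝ} (hP : P.PosSemidef) :
    kalmanGain H R P * (H * P * Hᵀ + R) = P * Hᵀ := by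
  rw [kalmanGain, Matrix.mul_assoc,
    Matrix.nonsing_inv_mul _
      ((Matrix.isUnit_iff_isUnit_det _).1 (innovation_posDef H hR hP).isUnit),
    Matrix.mul_one]

/-- This identity lets the innovation covariance be recovered from the gain alone. -/
theorem one_sub_mul_gain_mul_innovation [DecidableEq κ] (H : Matrix κ ι ℝ)
    {R : Matrix κ κ ℝ} (hR : R.PosDef) {P : Matrix ι ι ℝ} (hP : P.PosSemidef) :
    (1 - H * kalmanGain H R P) * (H * P * Hᵀ + R) = R := by
  rw [Matrix.sub_mul, Matrix.one_mul, Matrix.mul_assoc H (kalmanGain H R P),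
    kalmanGain_mul_innovation H hR hP,
    Matrix.mul_assoc, add_sub_cancel_left]

end QuadraticForms

/-! ### The Riccati recursion and convergence of the covariances. -/

section Riccati

open Matrix

variable {ι κ : Type*} [Fintype ι] [DecidableEq ι] [Fintype κ] [DecidableEq κ]

/-- Completion of the square: the covariance update with an arbitrary gain `K₀` exceeds the
posterior covariance by `(K₀ - K) S (K₀ - K)ᵀ`. -/
theorem joseph_eq_posteriorCov_add (H : Matrix κ ι ℝ) {R : Matrix κ κ ℝ} (hR : R.PosDef)
    {P : Matrix ι ι ℝ} (hP : P.PosSemidef) (K₀ : Matrix ι κ ℝ) :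
    (1 - K₀ * H) * P * (1 - K₀ * H)ᵀ + K₀ * R * K₀ᵀ =
      posteriorCov H R P +
        (K₀ - kalmanGain H R P) * (H * P * Hᵀ + R) * (K₀ - kalmanGain H R P)ᵀ := by
  have hPt : Pᵀ = P := hP.isHermitian
  have hRt : Rᵀ = R := hR.isHermitian
  have h1 := kalmanGain_mul_innovation H hR hP
  rw [posteriorCov]
  set K := kalmanGain H R P
  have h2 : (H * P * Hᵀ + R) * Kᵀ = H * P := by
    have := congrArg Matrix.transpose h1
    simpa [Matrix.transpose_mul, hPt, hRt, Matrix.mul_assoc] using this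
  have h3 : (K₀ - K) * (H * P * Hᵀ + R) * (K₀ - K)ᵀ =
      K₀ * (H * P * Hᵀ + R) * K₀ᵀ - K₀ * (H * P) - P * Hᵀ * K₀ᵀ + K * (H * P) := by
    have h4 : P * Hᵀ * Kᵀ = K * (H * P) := by rw [← h1, Matrix.mul_assoc, h2]
    rw [Matrix.transpose_sub, Matrix.sub_mul, h1, Matrix.mul_sub, Matrix.sub_mul, Matrix.sub_mul,
      Matrix.mul_assoc K₀ _ Kᵀ, h2, h4]
    abel
  rw [h3]
  simp only [Matrix.transpose_sub, Matrix.transpose_mul, Matrix.transpose_one, Matrix.sub_mul,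
    Matrix.mul_sub, Matrix.mul_add, Matrix.add_mul, Matrix.mul_one, Matrix.one_mul,
    Matrix.mul_assoc]
  abel

theorem posteriorCov_eq_joseph (H : Matrix κ ι ℝ) {R : Matrix κ κ ℝ} (hR : R.PosDef)
    {P : Matrix ι ι ℝ} (hP : P.PosSemidef) :
    posteriorCov H R P = (1 - kalmanGain H R P * H) * P * (1 - kalmanGain H R P * H)ᵀ +
      kalmanGain H R P * R * (kalmanGain H R P)ᵀ := by
  rw [joseph_eq_posteriorCov_add H hR hP]
  simp

theorem posteriorCov_posSemidef (H : Matrix κ ι ℝ) {R : Matrix κ κ ℝ} (hR : R.PosDef)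
    {P : Matrix ι ι ℝ} (hP : P.PosSemidef) : (posteriorCov H R P).PosSemidef := by
  rw [posteriorCov_eq_joseph H hR hP]
  exact (Matrix.PosSemidef.congruence hP _).add (Matrix.PosSemidef.congruence hR.posSemidef _)

/-- With the Kalman gain, `K R = P₊ Hᵀ`. -/
theorem kalmanGain_mul_noise (H : Matrix κ ι ℝ) {R : Matrix κ κ ℝ} (hR : R.PosDef)
    {P : Matrix ι ι ℝ} (hP : P.PosSemidef) :
    kalmanGain H R P * R = posteriorCov H R P * Hᵀ := by
  have h1 := kalmanGain_mul_innovation H hR hP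
  rw [posteriorCov, Matrix.sub_mul, Matrix.sub_mul, Matrix.one_mul, ← h1]
  simp only [Matrix.mul_add, Matrix.mul_assoc]
  abel

variable {Φ : Matrix ι ι ℝ} {H : Matrix κ ι ℝ} {Q : Matrix ι ι ℝ} {R : Matrix κ κ ℝ}
  {P₀ : Matrix ι ι ℝ}

theorem priorSeq_posSemidef (hQ : Q.PosSemidef) (hR : R.PosDef) (hP₀ : P₀.PosSemidef) (k : ℕ) :
    (priorSeq Φ H Q R P₀ k).PosSemidef := by
  induction k with
  | zero => exact hP₀
  | succ k ih => exact (Matrix.PosSemidef.congruence (posteriorCov_posSemidef H hR ih) Φ).add hQ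

theorem priorSeq_succ_eq (hQ : Q.PosSemidef) (hR : R.PosDef) (hP₀ : P₀.PosSemidef)
    (K₀ : Matrix ι κ ℝ) (k : ℕ) :
    priorSeq Φ H Q R P₀ (k + 1) =
      (Φ * (1 - K₀ * H)) * priorSeq Φ H Q R P₀ k * (Φ * (1 - K₀ * H))ᵀ +
        (Φ * (K₀ * R * K₀ᵀ - (K₀ - gainSeq Φ H Q R P₀ k) *
          (H * priorSeq Φ H Q R P₀ k * Hᵀ + R) * (K₀ - gainSeq Φ H Q R P₀ k)ᵀ) * Φᵀ + Q) := by
  have h := joseph_eq_posteriorCov_add H hR (priorSeq_posSemidef (Φ := Φ) (H := H) hQ hR hP₀ k) K₀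
  have h' := eq_sub_of_add_eq h.symm
  rw [priorSeq, h', gainSeq, ← add_assoc]
  congr 1
  rw [Matrix.transpose_mul]
  simp only [Matrix.mul_sub, Matrix.sub_mul, Matrix.mul_add, Matrix.add_mul, Matrix.mul_assoc]
  abel

theorem schurStable_mul_comm {M N : Matrix ι ι ℝ} (h : SchurStable (M * N)) :
    SchurStable (N * M) :=
  h.of_charpoly_eq (Matrix.charpoly_mul_comm M N)

/-- A stabilizing gain bounds the prior covariances by a convergent sequence. -/
theorem exists_tendsto_priorSeq_le (hQ : Q.PosSemidef) (hR : R.PosDef) (hP₀ : P₀.PosSemidef)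
    {K₀ : Matrix ι κ ℝ} (hK₀ : IsStabilizingGain Φ H K₀) :
    ∃ (U : ℕ → Matrix ι ι ℝ) (U' : Matrix ι ι ℝ), Tendsto U atTop (𝓝 U') ∧
      ∀ k, (U k - priorSeq Φ H Q R P₀ k).PosSemidef := by
  set F := Φ * (1 - K₀ * H) with hF
  set W := Φ * (K₀ * R * K₀ᵀ) * Φᵀ + Q with hW
  -- Error covariances of the filter run with the constant gain `K₀`.
  let U : ℕ → Matrix ι ι ℝ := fun k => Nat.rec P₀ (fun _ X => F * X * Fᵀ + W) k
  have hU : ∀ k, U (k + 1) = F * U k * Fᵀ + W := fun k => rfl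
  obtain ⟨U', hU'⟩ := (schurStable_mul_comm hK₀).exists_tendsto_of_recurrence hU
    tendsto_const_nhds
  refine ⟨U, U', hU', fun k => ?_⟩
  induction k with
  | zero => simpa [U, priorSeq] using Matrix.PosSemidef.zero
  | succ k ih =>
    have h1 := Matrix.PosSemidef.congruence (Matrix.PosSemidef.congruence (innovation_posDef H hR
      (priorSeq_posSemidef (Φ := Φ) (H := H) hQ hR hP₀ k)).posSemidef
        (K₀ - gainSeq Φ H Q R P₀ k)) Φ
    convert (Matrix.PosSemidef.congruence ih F).add h1 using 1
    rw [hU, priorSeq_succ_eq hQ hR hP₀ K₀]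
    simp only [← hF, hW, Matrix.mul_sub, Matrix.sub_mul]
    abel

theorem inv_mul_eq_of_mul_eq {M S N : Matrix κ κ ℝ} (hN : IsUnit N) (h : M * S = N) :
    M⁻¹ * N = S := by
  subst h
  have : IsUnit M.det := by
    rw [Matrix.isUnit_iff_isUnit_det, Matrix.det_mul] at hN
    exact isUnit_of_mul_isUnit_left hN
  exact Matrix.nonsing_inv_mul_cancel_left _ _ this

theorem tendsto_matrix_inv {α : Type*} {l : Filter α} {M : α → Matrix κ κ ℝ} {M' : Matrix κ κ ℝ}
    (hM : Tendsto M l (𝓝 M')) (hu : IsUnit M') : Tendsto (fun a => (M a)⁻¹) l (𝓝 M'⁻¹) := by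
  have h : ContinuousAt Inv.inv M' := by
    refine continuousAt_matrix_inv _ ?_
    have := (Matrix.isUnit_iff_isUnit_det _).1 hu
    simpa only [Ring.inverse_eq_inv'] using continuousAt_inv₀ this.ne_zero
  exact h.tendsto.comp hM

/-- If `(1 - H K)ᵀ x = 0`, then `r_k = (1 - H K_k)ᵀ x` tends to `0` while `S_k r_k = R x`. Since
`S_k` is bounded, `xᵀ R x = xᵀ S_k r_k` would tend to `0`, contradicting `R ≻ 0`. -/
theorem isUnit_one_sub_mul_gain (hQ : Q.PosSemidef) (hR : R.PosDef) (hP₀ : P₀.PosSemidef)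
    {K K₀ : Matrix ι κ ℝ} (hK : Tendsto (gainSeq Φ H Q R P₀) atTop (𝓝 K))
    (hK₀ : IsStabilizingGain Φ H K₀) : IsUnit (1 - H * K) := by
  obtain ⟨U, U', hU, hle⟩ := exists_tendsto_priorSeq_le (P₀ := P₀) hQ hR hP₀ hK₀
  set P := priorSeq Φ H Q R P₀
  have hP : ∀ k, (P k).PosSemidef := priorSeq_posSemidef hQ hR hP₀
  rw [Matrix.isUnit_iff_isUnit_det, ← Matrix.det_transpose, isUnit_iff_ne_zero]
  intro hdet
  obtain ⟨x, hx, hx0⟩ := Matrix.exists_mulVec_eq_zero_iff.2 hdet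
  let r : ℕ → κ → ℝ := fun k => (1 - H * gainSeq Φ H Q R P₀ k)ᵀ *ᵥ x
  have hr : Tendsto r atTop (𝓝 0) := by
    have hc : Continuous fun K : Matrix ι κ ℝ => (1 - H * K)ᵀ *ᵥ x := by fun_prop
    rw [← hx0]
    exact (hc.tendsto K).comp hK
  have hSr : ∀ k, (H * P k * Hᵀ + R) *ᵥ r k = R *ᵥ x := fun k => by
    have h := congrArg Matrix.transpose (one_sub_mul_gain_mul_innovation H hR (hP k))
    have hPt : (P k)ᵀ = P k := (hP k).isHermitian
    have hRt : Rᵀ = R := hR.isHermitian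
    rw [Matrix.transpose_mul, hRt, (innovation_posDef H hR (hP k)).isHermitian.eq.symm.trans
      (conjTranspose_eq_transpose_of_trivial _) |>.symm] at h
    simp only [r, Matrix.mulVec_mulVec]
    exact congrArg (· *ᵥ x) h
  have hpos : 0 < x ⬝ᵥ R *ᵥ x := by simpa using hR.dotProduct_mulVec_pos hx
  -- Expand `(x - t r_k)ᵀ S_k (x - t r_k) ≥ 0`, replace `P_k` by its bound `U_k` in the two square
  -- terms, and let `k → ∞`.
  have hub : ∀ t : ℝ, 0 ≤ x ⬝ᵥ (H * U' * Hᵀ + R) *ᵥ x - 2 * t * (x ⬝ᵥ R *ᵥ x) := fun t => by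
    have hUc : Tendsto (fun k => H * U k * Hᵀ + R) atTop (𝓝 (H * U' * Hᵀ + R)) := by
      have hc : Continuous fun X : Matrix ι ι ℝ => H * X * Hᵀ + R := by fun_prop
      exact (hc.tendsto U').comp hU
    have hlim := ((tendsto_quadForm hUc (tendsto_const_nhds (x := x))).sub
      (tendsto_const_nhds (x := 2 * t * (x ⬝ᵥ R *ᵥ x)))).add
        ((tendsto_quadForm hUc hr).const_mul (t ^ 2))
    simp only [Matrix.mulVec_zero, dotProduct_zero, mul_zero, add_zero] at hlim
    refine ge_of_tendsto' hlim fun k => ?_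
    have hd : ∀ v : κ → ℝ, v ⬝ᵥ (H * P k * Hᵀ + R) *ᵥ v ≤ v ⬝ᵥ (H * U k * Hᵀ + R) *ᵥ v :=
        fun v => by
      have h := (Matrix.PosSemidef.congruence (hle k) H).dotProduct_mulVec_nonneg v
      rw [Matrix.mul_sub, Matrix.sub_mul, Matrix.sub_mulVec, dotProduct_sub, star_trivial] at h
      rw [Matrix.add_mulVec, Matrix.add_mulVec, dotProduct_add, dotProduct_add]
      linarith
    have h0 := (innovation_posDef H hR (hP k)).posSemidef.dotProduct_mulVec_nonneg (x - t • r k)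
    have hsymm : r k ⬝ᵥ (H * P k * Hᵀ + R) *ᵥ x = x ⬝ᵥ R *ᵥ x := by
      rw [dotProduct_mulVec_comm_of_isSymm (M := H * P k * Hᵀ + R)
        (innovation_posDef H hR (hP k)).isHermitian, hSr]
    rw [star_trivial, Matrix.mulVec_sub, Matrix.mulVec_smul, hSr, sub_dotProduct, dotProduct_sub,
      dotProduct_sub, smul_dotProduct, smul_dotProduct, dotProduct_smul, dotProduct_smul, hsymm,
      ← hSr k] at h0
    have h1 := hd x
    have h2 := mul_le_mul_of_nonneg_left (hd (r k)) (sq_nonneg t)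
    rw [hSr] at h0 h2
    simp only [smul_eq_mul] at h0
    nlinarith
  -- This `t` makes the right-hand side of `hub` equal to `-1`.
  have := hub ((x ⬝ᵥ (H * U' * Hᵀ + R) *ᵥ x + 1) / (2 * (x ⬝ᵥ R *ᵥ x)))
  have h3 : 2 * ((x ⬝ᵥ (H * U' * Hᵀ + R) *ᵥ x + 1) / (2 * (x ⬝ᵥ R *ᵥ x))) * (x ⬝ᵥ R *ᵥ x) =
      x ⬝ᵥ (H * U' * Hᵀ + R) *ᵥ x + 1 := by
    field_simp
  linarith

theorem exists_tendsto_priorSeq (hQ : Q.PosSemidef) (hR : R.PosDef) (hP₀ : P₀.PosSemidef)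
    {K K₀ : Matrix ι κ ℝ} (hK : Tendsto (gainSeq Φ H Q R P₀) atTop (𝓝 K))
    (hK₀ : IsStabilizingGain Φ H K₀) :
    ∃ P, Tendsto (priorSeq Φ H Q R P₀) atTop (𝓝 P) := by
  have hu := isUnit_one_sub_mul_gain hQ hR hP₀ hK hK₀
  have hS : Tendsto (fun k => H * priorSeq Φ H Q R P₀ k * Hᵀ + R) atTop
      (𝓝 ((1 - H * K)⁻¹ * R)) := by
    have h1 : Tendsto (fun k => (1 - H * gainSeq Φ H Q R P₀ k)) atTop (𝓝 (1 - H * K)) := by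
      have hc : Continuous fun K : Matrix ι κ ℝ => 1 - H * K := by fun_prop
      exact (hc.tendsto K).comp hK
    exact ((tendsto_matrix_inv h1 hu).mul_const R).congr fun k =>
      inv_mul_eq_of_mul_eq hR.isUnit (one_sub_mul_gain_mul_innovation H hR
        (priorSeq_posSemidef (Φ := Φ) (H := H) hQ hR hP₀ k))
  have hc : Continuous fun p : Matrix ι κ ℝ × Matrix κ κ ℝ =>
      Φ * (K₀ * R * K₀ᵀ - (K₀ - p.1) * p.2 * (K₀ - p.1)ᵀ) * Φᵀ + Q := by fun_prop
  have hG := (hc.tendsto (K, (1 - H * K)⁻¹ * R)).comp (hK.prodMk_nhds hS)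
  exact (schurStable_mul_comm hK₀).exists_tendsto_of_recurrence
    (priorSeq_succ_eq hQ hR hP₀ K₀) hG

end Riccati

/-! ### Stability of the smoother gain at a Riccati fixed point. -/

section SteadyState

open Matrix
open scoped ComplexOrder MatrixOrder

theorem Matrix.PosSemidef.map_ofReal {ι : Type*} [Fintype ι] [DecidableEq ι] {P : Matrix ι ι ℝ}
    (hP : P.PosSemidef) : (P.map (algebraMap ℝ ℂ)).PosSemidef := by
  obtain ⟨B, rfl⟩ := CStarAlgebra.nonneg_iff_eq_star_mul_self.mp hP.nonneg
  rw [Matrix.map_mul]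
  convert posSemidef_conjTranspose_mul_self (B.map (algebraMap ℝ ℂ)) using 2
  ext i j
  simp

theorem conjTranspose_map_ofReal {ι κ : Type*} (M : Matrix ι κ ℝ) :
    (M.map (algebraMap ℝ ℂ))ᴴ = Mᵀ.map (algebraMap ℝ ℂ) := by
  ext i j
  simp

/-- Stands in for `P⁻¹` in the smoother gain when `P` is singular. -/
theorem exists_generalized_inverse {ι : Type*} [Fintype ι] [DecidableEq ι] (P : Matrix ι ι ℝ) :
    ∃ X : Matrix ι ι ℝ, P * X * P = P := by
  obtain ⟨g, hg⟩ := (toLin' P).rangeRestrict.exists_rightInverse_of_surjective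
    (LinearMap.range_rangeRestrict _)
  obtain ⟨X, hX⟩ := LinearMap.exists_extend g
  refine ⟨LinearMap.toMatrix' X, toLin'.injective ?_⟩
  refine LinearMap.ext fun v => ?_
  have h1 : X (toLin' P v) = g ((toLin' P).rangeRestrict v) :=
    LinearMap.congr_fun hX ((toLin' P).rangeRestrict v)
  have h2 := congrArg Subtype.val (LinearMap.congr_fun hg ((toLin' P).rangeRestrict v))
  simp only [toLin'_mul, toLin'_toMatrix', LinearMap.comp_apply] at h2 ⊢
  rw [h1]
  exact h2

variable {ι κ : Type*} [Fintype ι] [Fintype κ]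

theorem mulVec_eq_zero_of_add_mulVec_eq_zero {𝕜 : Type*} [RCLike 𝕜] {M N : Matrix ι ι 𝕜}
    (hM : M.PosSemidef) (hN : N.PosSemidef) {v : ι → 𝕜} (h : (M + N) *ᵥ v = 0) : M *ᵥ v = 0 := by
  have h1 : star v ⬝ᵥ M *ᵥ v + star v ⬝ᵥ N *ᵥ v = 0 := by
    rw [← dotProduct_add, ← add_mulVec, h, dotProduct_zero]
  exact (hM.dotProduct_mulVec_zero_iff v).1 ((add_eq_zero_iff_of_nonneg
    (hM.dotProduct_mulVec_nonneg v) (hN.dotProduct_mulVec_nonneg v)).1 h1).1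

theorem mulVec_conjTranspose_eq_zero_of_congruence {𝕜 : Type*} [RCLike 𝕜] {R : Matrix κ κ 𝕜}
    (hR : R.PosSemidef) (M : Matrix ι κ 𝕜) {v : ι → 𝕜} (h : (M * R * Mᴴ) *ᵥ v = 0) :
    R *ᵥ (Mᴴ *ᵥ v) = 0 := by
  refine (hR.dotProduct_mulVec_zero_iff _).1 ?_
  rw [star_mulVec, conjTranspose_conjTranspose, ← dotProduct_mulVec, mulVec_mulVec, mulVec_mulVec,
    h, dotProduct_zero]

/-- Pairing the Lyapunov equation with `v` gives `(1 - |z|²) v* P v = v* W v ≥ 0`, with `v* P v >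
0`. Equality forces `W v = 0`. -/
theorem norm_lt_one_or_of_lyapunov {P F W : Matrix ι ι ℂ} (hP : P.PosSemidef)
    (hW : W.PosSemidef) (hL : P = F * P * Fᴴ + W) {v : ι → ℂ} {z : ℂ}
    (hv : P *ᵥ (Fᴴ *ᵥ v) = z • P *ᵥ v) (hPv : P *ᵥ v ≠ 0) :
    ‖z‖ < 1 ∨ ‖z‖ = 1 ∧ W *ᵥ v = 0 ∧ z • F *ᵥ (P *ᵥ v) = P *ᵥ v := by
  have hsum : P *ᵥ v = z • F *ᵥ (P *ᵥ v) + W *ᵥ v := by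
    conv_lhs => rw [hL]
    rw [add_mulVec, ← mulVec_mulVec, ← mulVec_mulVec, hv, mulVec_smul]
  have hF : star v ⬝ᵥ F *ᵥ (P *ᵥ v) = star z * (star v ⬝ᵥ P *ᵥ v) := by
    have h1 := congrArg star hv
    rw [star_mulVec, star_mulVec, star_smul, star_mulVec, hP.isHermitian.eq,
      conjTranspose_conjTranspose] at h1
    rw [dotProduct_mulVec, dotProduct_mulVec, h1, smul_dotProduct, ← dotProduct_mulVec,
      smul_eq_mul]
  have hq : star v ⬝ᵥ P *ᵥ v =
      (‖z‖ ^ 2 : ℝ) * (star v ⬝ᵥ P *ᵥ v) + star v ⬝ᵥ W *ᵥ v := by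
    conv_lhs => rw [hsum]
    rw [dotProduct_add, dotProduct_smul, hF, smul_eq_mul, ← mul_assoc]
    congr 2
    rw [Complex.star_def, Complex.mul_conj', Complex.ofReal_pow]
  have hq0 : 0 < (star v ⬝ᵥ P *ᵥ v).re := by
    have h1 := hP.dotProduct_mulVec_nonneg v
    have h2 : star v ⬝ᵥ P *ᵥ v ≠ 0 := fun h => hPv ((hP.dotProduct_mulVec_zero_iff v).1 h)
    exact (Complex.pos_iff.1 (lt_of_le_of_ne h1 h2.symm)).1
  have hw0 := Complex.nonneg_iff.1 (hW.dotProduct_mulVec_nonneg v)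
  have hre := congrArg Complex.re hq
  rw [Complex.add_re, Complex.re_ofReal_mul] at hre
  refine (lt_or_ge ‖z‖ 1).imp_right fun hz => ?_
  have hz2 : 1 ≤ ‖z‖ ^ 2 := one_le_pow₀ hz
  have hw : (star v ⬝ᵥ W *ᵥ v).re = 0 := by nlinarith
  have hWv : W *ᵥ v = 0 := (hW.dotProduct_mulVec_zero_iff v).1 (Complex.ext hw hw0.2.symm)
  refine ⟨?_, hWv, by rw [hWv, add_zero] at hsum; exact hsum.symm⟩
  have : ‖z‖ ^ 2 = 1 := by nlinarith
  nlinarith [norm_nonneg z]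

variable [DecidableEq ι] [DecidableEq κ]
variable {Φ : Matrix ι ι ℝ} {H : Matrix κ ι ℝ} {Q : Matrix ι ι ℝ} {R : Matrix κ κ ℝ}
  {P : Matrix ι ι ℝ}

theorem posteriorCov_eq_mul_transpose (hR : R.PosDef) (hP : P.PosSemidef) :
    posteriorCov H R P = P * (1 - kalmanGain H R P * H)ᵀ := by
  have h1 : (posteriorCov H R P)ᵀ = posteriorCov H R P :=
    (posteriorCov_posSemidef H hR hP).isHermitian
  have h2 : Pᵀ = P := hP.isHermitian
  rw [← h1, posteriorCov, transpose_mul, h2]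

/-- The steady-state dynamics `Φ (I - K H)` restricted to the range of the covariance `P` has no
eigenvalue outside the open unit disc. -/
theorem norm_lt_one_of_riccati (hQ : Q.PosSemidef) (hR : R.PosDef) (hP : P.PosSemidef)
    (hric : P = Φ * posteriorCov H R P * Φᵀ + Q) {K₀ : Matrix ι κ ℝ}
    (hK₀ : IsStabilizingGain Φ H K₀) {v : ι → ℂ} {z : ℂ}
    (hv : (P * (Φ * (1 - kalmanGain H R P * H))ᵀ).map (algebraMap ℝ ℂ) *ᵥ v =
      z • P.map (algebraMap ℝ ℂ) *ᵥ v)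
    (hPv : P.map (algebraMap ℝ ℂ) *ᵥ v ≠ 0) : ‖z‖ < 1 := by
  set K := kalmanGain H R P with hKdef
  set F := Φ * (1 - K * H) with hF
  have hlyap : P = F * P * Fᵀ + (Φ * K * R * (Φ * K)ᵀ + Q) := by
    conv_lhs => rw [hric, posteriorCov_eq_joseph H hR hP]
    simp only [hF, ← hKdef, transpose_mul, Matrix.mul_add, Matrix.add_mul, Matrix.mul_assoc,
      add_assoc]
  have hW1 : (Φ * K * R * (Φ * K)ᵀ).PosSemidef := hR.posSemidef.congruence _
  have hlyapC := congrArg (fun M : Matrix ι ι ℝ => M.map (algebraMap ℝ ℂ)) hlyap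
  simp only [Matrix.map_add _ (map_add (algebraMap ℝ ℂ)), Matrix.map_mul (L := F * P),
    Matrix.map_mul (L := F), ← conjTranspose_map_ofReal F] at hlyapC
  rw [← Matrix.map_add _ (map_add (algebraMap ℝ ℂ))] at hlyapC
  have hv' : P.map (algebraMap ℝ ℂ) *ᵥ ((F.map (algebraMap ℝ ℂ))ᴴ *ᵥ v) =
      z • P.map (algebraMap ℝ ℂ) *ᵥ v := by
    rw [conjTranspose_map_ofReal, mulVec_mulVec, ← Matrix.map_mul, hv]
  rcases norm_lt_one_or_of_lyapunov hP.map_ofReal (hW1.add hQ).map_ofReal hlyapC hv' hPv with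
    h | ⟨hz, hWv, hFP⟩
  · exact h
  exfalso
  have hz0 : z ≠ 0 := by
    rintro rfl
    simp at hz
  -- `W v = 0` kills its summand `Φ K R (Φ K)ᵀ v`, hence `R (Φ K)ᵀ v = H P Fᵀ v = z H P v` vanishes.
  have hHPv : H.map (algebraMap ℝ ℂ) *ᵥ (P.map (algebraMap ℝ ℂ) *ᵥ v) = 0 := by
    rw [Matrix.map_add _ (map_add (algebraMap ℝ ℂ))] at hWv
    have h1 := mulVec_eq_zero_of_add_mulVec_eq_zero hW1.map_ofReal hQ.map_ofReal hWv
    rw [Matrix.map_mul, Matrix.map_mul, ← conjTranspose_map_ofReal] at h1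
    have h2 := mulVec_conjTranspose_eq_zero_of_congruence hR.posSemidef.map_ofReal _ h1
    have h3 : R * (Φ * K)ᵀ = H * (P * Fᵀ) := by
      have hRt : Rᵀ = R := hR.isHermitian
      have h4 := congrArg Matrix.transpose (kalmanGain_mul_noise H hR hP)
      have h5 : (posteriorCov H R P)ᵀ = posteriorCov H R P :=
        (posteriorCov_posSemidef H hR hP).isHermitian
      rw [transpose_mul, transpose_mul, hRt, transpose_transpose, h5,
        posteriorCov_eq_mul_transpose hR hP] at h4
      rw [transpose_mul, ← Matrix.mul_assoc, h4, hF, transpose_mul]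
      simp only [Matrix.mul_assoc, ← hKdef]
    rw [conjTranspose_map_ofReal, mulVec_mulVec, ← Matrix.map_mul, h3, Matrix.map_mul,
      ← mulVec_mulVec, hv, mulVec_smul] at h2
    exact (smul_eq_zero.1 h2).resolve_left hz0
  -- On a vector killed by `H` all gains act alike, so the eigenvalue `z⁻¹` of `F` at `P v`, of
  -- modulus one, is also one of `Φ (1 - K₀ H)`.
  have hgain : ∀ G : Matrix ι κ ℝ, (Φ * (1 - G * H)).map (algebraMap ℝ ℂ) *ᵥ
      (P.map (algebraMap ℝ ℂ) *ᵥ v) =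
        Φ.map (algebraMap ℝ ℂ) *ᵥ (P.map (algebraMap ℝ ℂ) *ᵥ v) := fun G => by
    rw [Matrix.mul_sub, Matrix.mul_one, ← Matrix.mul_assoc,
      Matrix.map_sub _ (map_sub (algebraMap ℝ ℂ)), sub_mulVec, Matrix.map_mul (M := H),
      ← mulVec_mulVec _ _ (H.map (algebraMap ℝ ℂ)), hHPv, mulVec_zero, sub_zero]
  have hstab : SchurStable (Φ * (1 - K₀ * H)) := schurStable_mul_comm hK₀
  have := hstab.norm_lt_one hPv (z := z⁻¹) (by
    rw [hgain, ← hgain K, ← hF]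
    conv_rhs => rw [← hFP]
    rw [smul_smul, inv_mul_cancel₀ hz0, one_smul])
  rw [norm_inv, hz, inv_one] at this
  exact lt_irrefl _ this

/-- A steady-state covariance `P` has a smoother gain which is Schur stable. -/
theorem exists_schurStable_smootherGain (hQ : Q.PosSemidef) (hR : R.PosDef) (hP : P.PosSemidef)
    (hric : P = Φ * posteriorCov H R P * Φᵀ + Q) {K₀ : Matrix ι κ ℝ}
    (hK₀ : IsStabilizingGain Φ H K₀) :
    ∃ L : Matrix ι ι ℝ, L * P = posteriorCov H R P * Φᵀ ∧ SchurStable L := by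
  obtain ⟨X, hX⟩ := exists_generalized_inverse P
  have hpost := posteriorCov_posSemidef H hR hP
  -- `P` is the sum of the semidefinite `Φ P₊ Φᵀ` and `Q`, so its kernel lies in that of `P₊ Φᵀ`;
  -- this is what makes `L P = P₊ Φᵀ` solvable.
  have hker : ∀ x, P *ᵥ x = 0 → posteriorCov H R P *ᵥ (Φᵀ *ᵥ x) = 0 := fun x hx => by
    rw [hric] at hx
    have h1 := mulVec_eq_zero_of_add_mulVec_eq_zero (hpost.congruence Φ) hQ hx
    rw [← conjTranspose_eq_transpose_of_trivial] at h1 ⊢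
    exact mulVec_conjTranspose_eq_zero_of_congruence hpost Φ h1
  have hLP : posteriorCov H R P * Φᵀ * X * P = posteriorCov H R P * Φᵀ := by
    refine Matrix.ext_iff_mulVec.2 fun x => ?_
    have h1 := hker ((X * P) *ᵥ x - x) (by
      rw [mulVec_sub, mulVec_mulVec, ← Matrix.mul_assoc, hX, sub_self])
    rw [mulVec_sub, mulVec_sub, sub_eq_zero] at h1
    simpa only [mulVec_mulVec, Matrix.mul_assoc] using h1
  refine ⟨_, hLP, fun z hz => ?_⟩
  obtain ⟨u, hu⟩ := hz.exists_hasEigenvector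
  have hu1 := hu.apply_eq_smul
  rw [toLin'_apply] at hu1
  rcases eq_or_ne z 0 with rfl | hz0
  · simp
  have hpF : posteriorCov H R P * Φᵀ = P * (Φ * (1 - kalmanGain H R P * H))ᵀ := by
    rw [posteriorCov_eq_mul_transpose hR hP, transpose_mul, Matrix.mul_assoc]
  set F := Φ * (1 - kalmanGain H R P * H)
  -- An eigenvector for `z ≠ 0` lies in the range of `P`; this preimage serves as `v` in the
  -- Lyapunov argument.
  have huP : P.map (algebraMap ℝ ℂ) *ᵥ (z⁻¹ • (Fᵀ * X).map (algebraMap ℝ ℂ) *ᵥ u) = u := by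
    rw [mulVec_smul, mulVec_mulVec, ← Matrix.map_mul, ← Matrix.mul_assoc, ← hpF, hu1, smul_smul,
      inv_mul_cancel₀ hz0, one_smul]
  refine norm_lt_one_of_riccati hQ hR hP hric hK₀
    (v := z⁻¹ • (Fᵀ * X).map (algebraMap ℝ ℂ) *ᵥ u) ?_ ?_
  · rw [← hpF, ← hLP, Matrix.map_mul (M := P), ← mulVec_mulVec, huP, hu1]
  · rw [huP]
    exact hu.2

end SteadyState

/-! ### Passage to the limit in the filter equations. -/

section Limits

open Matrix

theorem Matrix.PosSemidef.of_tendsto {ι α : Type*} [Fintype ι] {l : Filter α} [l.NeBot]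
    {M : α → Matrix ι ι ℝ} {M' : Matrix ι ι ℝ} (hM : Tendsto M l (𝓝 M'))
    (h : ∀ a, (M a).PosSemidef) : M'.PosSemidef := by
  refine PosSemidef.of_dotProduct_mulVec_nonneg ?_ fun x => ?_
  · have hc : Continuous fun X : Matrix ι ι ℝ => Xᴴ := by fun_prop
    exact tendsto_nhds_unique (((hc.tendsto M').comp hM).congr fun a => (h a).isHermitian) hM
  · rw [star_trivial]
    exact ge_of_tendsto' (tendsto_quadForm hM tendsto_const_nhds) fun a => by
      simpa using (h a).dotProduct_mulVec_nonneg x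

theorem tendsto_matrix_mul {ι κ μ α : Type*} [Fintype κ] {l : Filter α} {M : α → Matrix ι κ ℝ}
    {N : α → Matrix κ μ ℝ} {M' : Matrix ι κ ℝ} {N' : Matrix κ μ ℝ} (hM : Tendsto M l (𝓝 M'))
    (hN : Tendsto N l (𝓝 N')) : Tendsto (fun a => M a * N a) l (𝓝 (M' * N')) := by
  have hc : Continuous fun p : Matrix ι κ ℝ × Matrix κ μ ℝ => p.1 * p.2 := by fun_prop
  have h := (hc.tendsto (M', N')).comp (hM.prodMk_nhds hN)
  exact h

theorem tendsto_kalmanGain {ι κ α : Type*} [Fintype ι] [Fintype κ] [DecidableEq κ]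
    {l : Filter α} {M : α → Matrix ι ι ℝ} {P : Matrix ι ι ℝ} (H : Matrix κ ι ℝ)
    {R : Matrix κ κ ℝ} (hR : R.PosDef) (hP : P.PosSemidef) (hM : Tendsto M l (𝓝 P)) :
    Tendsto (fun a => kalmanGain H R (M a)) l (𝓝 (kalmanGain H R P)) := by
  have h1 : Tendsto (fun a => H * M a * Hᵀ + R) l (𝓝 (H * P * Hᵀ + R)) :=
    (tendsto_matrix_mul (tendsto_matrix_mul tendsto_const_nhds hM) tendsto_const_nhds).add_const R
  exact tendsto_matrix_mul (tendsto_matrix_mul hM tendsto_const_nhds)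
    (tendsto_matrix_inv h1 (innovation_posDef H hR hP).isUnit)

/-- `det (1 - K H) = det (1 - H K)`, and `(1 - H K) S = R` is invertible. -/
theorem isUnit_one_sub_gain_mul {ι κ : Type*} [Fintype ι] [DecidableEq ι] [Fintype κ]
    [DecidableEq κ] (H : Matrix κ ι ℝ) {R : Matrix κ κ ℝ} (hR : R.PosDef) {P : Matrix ι ι ℝ}
    (hP : P.PosSemidef) : IsUnit (1 - kalmanGain H R P * H) := by
  rw [Matrix.isUnit_iff_isUnit_det, Matrix.det_one_sub_mul_comm]
  refine isUnit_of_mul_isUnit_left (y := (H * P * Hᵀ + R).det) ?_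
  rw [← Matrix.det_mul, one_sub_mul_gain_mul_innovation H hR hP]
  exact (Matrix.isUnit_iff_isUnit_det _).1 hR.isUnit

end Limits

/-- Infinite-time smoother gain of the augmented system. The stabilizability hypothesis `hstab`
holds in particular when the limit gain `K` is itself stabilizing (take `K₀ = K`). -/
theorem theorem2 {n m ν : ℕ}
    (A : Matrix (Fin n) (Fin n) ℝ) (B : Matrix (Fin n) (Fin m) ℝ)
    (C : Matrix (Fin ν) (Fin n) ℝ) (D : Matrix (Fin ν) (Fin m) ℝ)
    (Φ : Matrix (Fin n ⊕ Fin m) (Fin n ⊕ Fin m) ℝ) (hΦ : Φ = augPhi A B)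
    (H : Matrix (Fin ν ⊕ Fin m) (Fin n ⊕ Fin m) ℝ) (hH : H = augH C D)
    (Q : Matrix (Fin n ⊕ Fin m) (Fin n ⊕ Fin m) ℝ) (hQ : Q.PosSemidef)
    (R : Matrix (Fin ν ⊕ Fin m) (Fin ν ⊕ Fin m) ℝ) (hR : R.PosDef)
    (P₀ : Matrix (Fin n ⊕ Fin m) (Fin n ⊕ Fin m) ℝ) (hP₀ : P₀.PosSemidef)
    (K : Matrix (Fin n ⊕ Fin m) (Fin ν ⊕ Fin m) ℝ)
    (hK : Tendsto (gainSeq Φ H Q R P₀) atTop (𝓝 K))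
    (hstab : ∃ K₀ : Matrix (Fin n ⊕ Fin m) (Fin ν ⊕ Fin m) ℝ, IsStabilizingGain Φ H K₀) :
    ∃ Pprior Ppost L : Matrix (Fin n ⊕ Fin m) (Fin n ⊕ Fin m) ℝ,
      Tendsto (priorSeq Φ H Q R P₀) atTop (𝓝 Pprior) ∧
      Tendsto (posteriorSeq Φ H Q R P₀) atTop (𝓝 Ppost) ∧
      K = kalmanGain H R Pprior ∧
      Ppost = (1 - K * H) * Pprior ∧
      Pprior = Φ * Ppost * Φ.transpose + Q ∧
      L * Pprior = Ppost * Φ.transpose ∧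
      SchurStable L ∧
      (IsUnit Pprior →
        L = Ppost * Φ.transpose * Pprior⁻¹ ∧
        IsUnit Ppost ∧
        L = Ppost * Φ.transpose * Ppost⁻¹ * (1 - K * H) ∧
        Tendsto (smootherGainSeq Φ H Q R P₀) atTop (𝓝 L) ∧
        IsStabilizingGain Φ H K) := by
  obtain ⟨K₀, hK₀⟩ := hstab
  obtain ⟨P, hP⟩ := exists_tendsto_priorSeq hQ hR hP₀ hK hK₀
  have hPpsd : P.PosSemidef := .of_tendsto hP (priorSeq_posSemidef hQ hR hP₀)
  obtain rfl : K = kalmanGain H R P :=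
    tendsto_nhds_unique hK (tendsto_kalmanGain H hR hPpsd hP)
  have hpost : Tendsto (posteriorSeq Φ H Q R P₀) atTop (𝓝 (posteriorCov H R P)) :=
    tendsto_matrix_mul (tendsto_const_nhds.sub (tendsto_matrix_mul hK tendsto_const_nhds)) hP
  have hPsucc : Tendsto (fun k => priorSeq Φ H Q R P₀ (k + 1)) atTop (𝓝 P) :=
    hP.comp (tendsto_add_atTop_nat 1)
  have hric : P = Φ * posteriorCov H R P * Φ.transpose + Q :=
    tendsto_nhds_unique hPsucc
      ((tendsto_matrix_mul (tendsto_matrix_mul tendsto_const_nhds hpost)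
        tendsto_const_nhds).add_const Q)
  obtain ⟨L, hLP, hL⟩ := exists_schurStable_smootherGain hQ hR hPpsd hric hK₀
  refine ⟨P, posteriorCov H R P, L, hP, hpost, rfl, rfl, hric, hLP, hL, fun hu => ?_⟩
  have hud := (Matrix.isUnit_iff_isUnit_det _).1 hu
  have hLeq : L = posteriorCov H R P * Φ.transpose * P⁻¹ := by
    rw [← hLP, Matrix.mul_nonsing_inv_cancel_right _ _ hud]
  have huK := isUnit_one_sub_gain_mul H hR hPpsd
  have hupost : IsUnit (posteriorCov H R P) := huK.mul hu
  have hinv : (posteriorCov H R P)⁻¹ * (1 - kalmanGain H R P * H) = P⁻¹ := by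
    rw [posteriorCov, Matrix.mul_inv_rev, Matrix.mul_assoc,
      Matrix.nonsing_inv_mul _ ((Matrix.isUnit_iff_isUnit_det _).1 huK), Matrix.mul_one]
  refine ⟨hLeq, hupost, ?_, ?_, ?_⟩
  · rw [Matrix.mul_assoc _ (posteriorCov H R P)⁻¹, hinv, hLeq]
  · rw [hLeq]
    exact tendsto_matrix_mul (tendsto_matrix_mul hpost tendsto_const_nhds)
      (tendsto_matrix_inv hPsucc hu)
  -- `L = P Fᵀ P⁻¹` has the characteristic polynomial of `F = Φ (1 - K H)`; swapping the factors
  -- gives `(1 - K H) Φ`.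
  · refine schurStable_mul_comm (hL.of_charpoly_eq ?_)
    rw [hLeq, posteriorCov_eq_mul_transpose hR hPpsd, Matrix.mul_assoc P, Matrix.mul_assoc P,
      Matrix.charpoly_mul_comm, Matrix.mul_assoc, Matrix.nonsing_inv_mul _ hud, Matrix.mul_one,
      ← Matrix.transpose_mul, Matrix.charpoly_transpose]
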